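/- Let $p$ be a prime, $q=p^s$ with $s\ge 1$, $A=\mathbb{F}_q[t]$, and let $K_\infty=\mathbb{F}_q((1/t))$ be the completion of $\mathbb{F}_q(t)$ at the infinite place. For positive integers $s_1,\dots,s_r$ put $$\zeta(s_1,\dots,s_r)=\sum \frac{1}{a_1^{s_1}\cdots a_r^{s_r}}\in K_\infty,$$ where the sum is over all $r$-tuples of monic polynomials $a_1,\dots,a_r\in A$ with $\deg a_1>\deg a_2>\dots>\deg a_r\ge 0$. Put $r_2=(q-1)p^m$, where $m$ is the smallest integer with $2\le p^m$ (so $m=1$ and $r_2=(q-1)p$), and $\phi(i,k)=r_2-2-k(q-1)+i\,r_2$. Let $[x\in\mathbb{Z}]$ be $1$ if $x$ is an integer and $0$ otherwise. Then all the series $\zeta(s_1,\dots,s_r)$ with positive integers $s_1,\dots,s_r$ converge (unconditionally) in $K_\infty$, and for every integer $b\ge 1$ $$\begin{aligned}\zeta(2)\zeta(b)={}&\zeta(2+b)+\zeta(2,b)+\zeta(b,2)\\&+\sum_{j=0}^{p-1}(j+2)\sum_{\substack{i\ge 0\\ b-\phi(i,p-1-j)>2}}\zeta\bigl(b-\phi(i,p-1-j),\,2+\phi(i,p-1-j)\bigr)\\&+\Bigl[\tfrac{b}{q-1}\in\mathbb{Z}\Bigr]\tfrac{b}{q-1}\,\zeta(2,b),\end{aligned}$$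 where the inner sums over $i$ are finite and the integer coefficients are read in $\mathbb{F}_p\subset K_\infty$. -/

import Mathlib

open scoped Polynomial

open scoped Classical in
/-- `K_∞ = F((1/t))`, the completion of `K = F(t)` at the place at infinity. -/
noncomputable abbrev KInfty (F : Type*) [Field F] : Type _ :=
  RatFunc.CompletionAtInfty F

/-- The indexing set of a multizeta value of depth `r` over `A = F[t]`: the `r`-tuples
`(a₁, …, a_r)` of monic polynomials with `deg a₁ > deg a₂ > ⋯ > deg a_r (≥ 0)`. -/
def MonicTuple (F : Type*) [Field F] (r : ℕ) : Type _ :=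
  {a : Fin r → F[X] // (∀ i, (a i).Monic) ∧ StrictAnti fun i => (a i).natDegree}

/-- The term `1 / (a₁ ^ s₁ ⋯ a_r ^ s_r)`, an element of `K_∞`. -/
noncomputable def multizetaTerm (F : Type*) [Field F] {r : ℕ} (s : Fin r → ℤ)
    (a : MonicTuple F r) : KInfty F :=
  ∏ i, 1 / algebraMap (RatFunc F) (KInfty F)
    (algebraMap F[X] (RatFunc F) (a.1 i)) ^ s i

/-- The multizeta value `ζ(s₁, …, s_r) = ∑ 1 / (a₁ ^ s₁ ⋯ a_r ^ s_r) ∈ K_∞` of Thakur, for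
positive integers `s₁, …, s_r`. For `r = 1` this is the Carlitz zeta value `ζ(s)`. -/
noncomputable def multizeta (F : Type*) [Field F] {r : ℕ} (s : Fin r → ℤ) :
    KInfty F :=
  ∑' a : MonicTuple F r, multizetaTerm F s a

/-- `r_a = (q - 1) p ^ m`, where `m` is the smallest integer with `a ≤ p ^ m`
(`Nat.clog p a` is this `m`, for `p` prime and `a` positive). -/
def recursionLength (p q a : ℕ) : ℤ :=
  ((q : ℤ) - 1) * (p : ℤ) ^ Nat.clog p a

/-- `φ(i, j) = r_a - a - j (q - 1) + i r_a`. -/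
def shufflePhi (p q a : ℕ) (i j : ℕ) : ℤ :=
  recursionLength p q a - a - j * ((q : ℤ) - 1) + i * recursionLength p q a

/-- The set of indices `i ≥ 0` with `b - φ(i, k) > a`, where `φ` is formed with `a`. -/
def shuffleIndexSet (p q a b k : ℕ) : Set ℕ :=
  {i | (b : ℤ) - shufflePhi p q a i k > a}

theorem shuffleIndexSet_finite {p q : ℕ} (hp : 1 < p) (hq : 1 < q) (a b k : ℕ) :
    (shuffleIndexSet p q a b k).Finite := by
  have hr : 1 ≤ recursionLength p q a := by
    have h1 : (1 : ℤ) ≤ (q : ℤ) - 1 := by omega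
    have h2 : (1 : ℤ) ≤ (p : ℤ) ^ Nat.clog p a := one_le_pow₀ (by exact_mod_cast hp.le)
    unfold recursionLength
    nlinarith
  refine (Set.finite_Iio (b + k * q)).subset fun i hi => ?_
  simp only [shuffleIndexSet, shufflePhi, Set.mem_ofPred_eq] at hi
  have hi' : (i : ℤ) ≤ i * recursionLength p q a := by nlinarith [Int.natCast_nonneg i]
  have hk : (0 : ℤ) ≤ k := Int.natCast_nonneg k
  have : (i : ℤ) < b + k * q := by nlinarith
  rw [Set.mem_Iio]
  exact_mod_cast this

/-! Truncate at `deg < D` and multiply the two finite sums. Pairs `(a, c)` with `a = c` or unequal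
degrees give the first three terms. For distinct monic `a`, `c` of equal degree, expand `1/(a^2
c^b)` in partial fractions in `a`, `c` and `c - a` (`partial_fraction_sq`). Here `c - a = θ m` with
`θ` a unit and `m` monic of smaller degree (`sum_monicSiblings`), and the sum of `θ^(-l)` over units
is `-1` if `q - 1 ∣ l` and `0` otherwise. Only double sums with exponents `(b + 2 - l, l)`, `q - 1 ∣
l`, survive (`sum_monicSiblings_sq_mul_pow`).

The identity is exact for every `D`, so letting `D` grow gives `multizeta_two_mul`. Writing `l = (q
- 1)(j + 1 + p i)` with `0 ≤ j < p` makes the coefficient `1 - l` equal to `j + 2` in characteristic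
`p` (`sum_mul_finsum_shuffle`). -/

/-! ### Convergence in the completion at infinity -/

instance KInfty.instCompleteSpace (F : Type*) [Field F] : CompleteSpace (KInfty F) := by
  classical
  let _ := RatFunc.inftyValued F
  exact UniformSpace.Completion.completeSpace (RatFunc F)

open scoped Classical in
theorem KInfty.valued_algebraMap (F : Type*) [Field F] (x : RatFunc F) :
    Valued.v (algebraMap (RatFunc F) (KInfty F) x) = RatFunc.inftyValuation F x := by
  let _ := RatFunc.inftyValued F
  exact Valued.valuedCompletion_apply x

instance KInfty.instNonarchimedeanRing (F : Type*) [Field F] : NonarchimedeanRing (KInfty F) where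
  is_nonarchimedean U hU := by
    obtain ⟨γ, hγ⟩ := Valued.mem_nhds_zero.1 hU
    refine ⟨⟨((Valued.v (R := KInfty F)).restrict.ltAddSubgroup γ), ?_⟩, hγ⟩
    exact Valued.isOpen_ball _ _

open WithZero in
theorem KInfty.exists_exp_le_of_mem_nhds_zero {F : Type*} [Field F] {U : Set (KInfty F)}
    (hU : U ∈ nhds 0) : ∃ n : ℕ, ∀ x : KInfty F, Valued.v x ≤ exp (-(n : ℤ)) → x ∈ U := by
  obtain ⟨γ, hγ⟩ := Valued.mem_nhds_zero.1 hU
  obtain ⟨m, hm⟩ : ∃ m : ℤ, MonoidWithZeroHom.ValueGroup₀.embedding γ.1 = exp m := by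
    have : MonoidWithZeroHom.ValueGroup₀.embedding γ.1 ≠ 0 := by simp
    exact ⟨_, (exp_log this).symm⟩
  -- The extra `1` gives `-n < m`, turning the bound `≤` into the strict inequality defining the
  -- ball.
  refine ⟨(-m).toNat + 1, fun x hx => hγ ?_⟩
  show Valued.v.restrict x < γ.1
  rw [Valuation.restrict_lt_iff_lt_embedding, hm]
  refine hx.trans_lt ?_
  rw [exp_lt_exp]
  omega

/-- The embedding of `F[t]` into `K_∞`. -/
noncomputable def polyToKInfty (F : Type*) [Field F] : F[X] →+* KInfty F :=
  (algebraMap (RatFunc F) (KInfty F)).comp (algebraMap F[X] (RatFunc F))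

theorem polyToKInfty_injective (F : Type*) [Field F] : Function.Injective (polyToKInfty F) :=
  (algebraMap (RatFunc F) (KInfty F)).injective.comp (RatFunc.algebraMap_injective F)

open WithZero in
theorem valued_polyToKInfty {F : Type*} [Field F] {a : F[X]} (ha : a ≠ 0) :
    Valued.v (polyToKInfty F a) = exp (a.natDegree : ℤ) := by
  classical
  exact (KInfty.valued_algebraMap F _).trans (RatFunc.inftyValuation.polynomial F ha)

open WithZero in
theorem valued_multizetaTerm {F : Type*} [Field F] {r : ℕ} (s : Fin r → ℤ) (a : MonicTuple F r) :
    Valued.v (multizetaTerm F s a) = exp (-∑ i, s i * ((a.1 i).natDegree : ℤ)) := by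
  have h (i : Fin r) : Valued.v (1 / algebraMap (RatFunc F) (KInfty F)
      (algebraMap F[X] (RatFunc F) (a.1 i)) ^ s i) = exp (-(s i * ((a.1 i).natDegree : ℤ))) := by
    have := valued_polyToKInfty (a.2.1 i).ne_zero
    simp only [polyToKInfty, RingHom.comp_apply] at this
    rw [one_div, map_inv₀, map_zpow₀, this, ← exp_zsmul, exp_neg, smul_eq_mul]
  rw [multizetaTerm, map_prod, Finset.prod_congr rfl fun i _ => h i, ← Finset.sum_neg_distrib]
  exact (map_prod (M := Multiplicative ℤ) WithZero.coeMonoidHom _ _).symm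

theorem finite_natDegree_lt (F : Type*) [Field F] [Finite F] (D : ℕ) :
    {a : F[X] | a.natDegree < D}.Finite := by
  have : Finite (Polynomial.degreeLT F D) :=
    Finite.of_equiv _ (Polynomial.degreeLTEquiv F D).symm.toEquiv
  refine Set.Finite.subset (Set.toFinite (Polynomial.degreeLT F D : Set F[X])) fun a ha => ?_
  rw [SetLike.mem_coe, Polynomial.mem_degreeLT]
  exact Polynomial.degree_lt_iff_coeff_zero _ _ |>.2 fun m hm =>
    Polynomial.coeff_eq_zero_of_natDegree_lt (lt_of_lt_of_le ha hm)

theorem finite_monicTuple_natDegree_lt (F : Type*) [Field F] [Finite F] (r D : ℕ) :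
    {a : MonicTuple F r | ∀ i, (a.1 i).natDegree < D}.Finite := by
  refine Set.Finite.of_finite_image (f := Subtype.val) ?_ Subtype.val_injective.injOn
  refine (Set.Finite.pi' fun _ : Fin r => finite_natDegree_lt F D).subset ?_
  rintro _ ⟨a, ha, rfl⟩
  exact ha

/-- In a complete nonarchimedean group it suffices that terms tend to `0` along the cofinite filter:
a large degree makes a term small, and only finitely many tuples have bounded degrees. -/
theorem summable_multizetaTerm {F : Type*} [Field F] [Finite F] {r : ℕ} {s : Fin r → ℤ}
    (hs : ∀ i, 0 < s i) : Summable (multizetaTerm F s) := by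
  refine NonarchimedeanAddGroup.summable_of_tendsto_cofinite_zero fun U hU => ?_
  obtain ⟨n, hn⟩ := KInfty.exists_exp_le_of_mem_nhds_zero hU
  refine (finite_monicTuple_natDegree_lt F r n).subset fun a ha i => ?_
  by_contra! hi
  refine ha (hn _ ?_)
  rw [valued_multizetaTerm, WithZero.exp_le_exp, neg_le_neg_iff]
  calc (n : ℤ) ≤ (a.1 i).natDegree := by exact_mod_cast hi
    _ ≤ s i * (a.1 i).natDegree := le_mul_of_one_le_left (by positivity) (hs i)
    _ ≤ _ := Finset.single_le_sum (f := fun i => s i * ((a.1 i).natDegree : ℤ))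
      (fun j _ => mul_nonneg (hs j).le (by positivity)) (Finset.mem_univ i)

/-- The monic polynomials of degree less than `D`. -/
noncomputable def monicLT (F : Type*) [Field F] [Finite F] (D : ℕ) : Finset F[X] :=
  ((finite_natDegree_lt F D).inter_of_right {a | a.Monic}).toFinset

@[simp]
theorem mem_monicLT {F : Type*} [Field F] [Finite F] {D : ℕ} {a : F[X]} :
    a ∈ monicLT F D ↔ a.Monic ∧ a.natDegree < D := by
  simp [monicLT]

/-! ### Zeta values as limits of degree truncations -/

open Filter Topology

theorem tendsto_sum_multizeta {F : Type*} [Field F] [Finite F] {r : ℕ} {s : Fin r → ℤ}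
    (hs : ∀ i, 0 < s i) :
    Tendsto (fun D => ∑ a ∈ (finite_monicTuple_natDegree_lt F r D).toFinset, multizetaTerm F s a)
      atTop (𝓝 (multizeta F s)) := by
  refine (summable_multizetaTerm hs).hasSum.comp (tendsto_atTop_finset_of_monotone ?_ ?_)
  · intro D E h a
    simp only [Set.Finite.mem_toFinset]
    exact fun ha i => (ha i).trans_le h
  · intro a
    refine ⟨∑ i, (a.1 i).natDegree + 1, ?_⟩
    simp only [Set.Finite.mem_toFinset]
    exact fun i => Nat.lt_succ_of_le (Finset.single_le_sum (f := fun i => (a.1 i).natDegree)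
      (fun _ _ => Nat.zero_le _) (Finset.mem_univ i))

theorem tendsto_sum_multizeta_one {F : Type*} [Field F] [Finite F] {s : ℕ} (hs : 0 < s) :
    Tendsto (fun D => ∑ a ∈ monicLT F D, (polyToKInfty F a)⁻¹ ^ s)
      atTop (𝓝 (multizeta F ![(s : ℤ)])) := by
  refine (tendsto_sum_multizeta (s := ![(s : ℤ)]) (by simpa using hs)).congr fun D => ?_
  refine Finset.sum_bij' (fun a _ => a.1 0)
    (fun a ha => ⟨![a], by simpa using (mem_monicLT.1 ha).1, Subsingleton.strictAnti _⟩) ?_ ?_ ?_ ?_ ?_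
  · intro a ha
    simp only [Set.Finite.mem_toFinset] at ha
    exact mem_monicLT.2 ⟨a.2.1 0, ha 0⟩
  · intro a ha
    refine (Set.Finite.mem_toFinset _).2 fun i => ?_
    fin_cases i
    exact (mem_monicLT.1 ha).2
  · intro a ha
    refine Subtype.ext (funext fun i => ?_)
    fin_cases i
    rfl
  · simp
  · intro a ha
    simp [multizetaTerm, polyToKInfty]

/-- Bounding `deg a` by `D` is enough, since `deg c < deg a`. -/
theorem tendsto_sum_multizeta_two {F : Type*} [Field F] [Finite F] {s t : ℕ} (hs : 0 < s)
    (ht : 0 < t) :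
    Tendsto (fun D => ∑ a ∈ monicLT F D, ∑ c ∈ monicLT F a.natDegree,
        (polyToKInfty F a)⁻¹ ^ s * (polyToKInfty F c)⁻¹ ^ t)
      atTop (𝓝 (multizeta F ![(s : ℤ), (t : ℤ)])) := by
  have hst : ∀ i, 0 < ![(s : ℤ), (t : ℤ)] i := by
    simp [Fin.forall_fin_two, hs, ht]
  refine (tendsto_sum_multizeta hst).congr fun D => ?_
  rw [Finset.sum_sigma']
  refine Finset.sum_bij' (fun a _ => ⟨a.1 0, a.1 1⟩)
    (fun x hx => ⟨![x.1, x.2], ?_, ?_⟩) ?_ ?_ ?_ ?_ ?_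
  · simp only [Finset.mem_sigma, mem_monicLT] at hx
    simp [Fin.forall_fin_two, hx.1.1, hx.2.1]
  · simp only [Finset.mem_sigma, mem_monicLT] at hx
    rw [Fin.strictAnti_iff_succ_lt]
    simpa using hx.2.2
  · intro a ha
    simp only [Set.Finite.mem_toFinset] at ha
    simp only [Finset.mem_sigma, mem_monicLT]
    exact ⟨⟨a.2.1 0, ha 0⟩, a.2.1 1, a.2.2 (by simp)⟩
  · intro x hx
    simp only [Finset.mem_sigma, mem_monicLT] at hx
    refine (Set.Finite.mem_toFinset _).2 fun i => ?_
    fin_cases i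
    exacts [hx.1.2, hx.2.2.trans hx.1.2]
  · intro a ha
    refine Subtype.ext (funext fun i => ?_)
    fin_cases i <;> rfl
  · simp
  · intro a ha
    simp [multizetaTerm, polyToKInfty, Fin.prod_univ_two, mul_comm]

/-! ### Partial fractions -/

/-- Induction on `b`: multiply by `y⁻¹` and split each product `x⁻¹ * y⁻¹` by `1/(xy) = (1/x -
1/y)/(y - x)`. -/
theorem partial_fraction_sq {K : Type*} [Field K] {x y : K} (hx : x ≠ 0) (hy : y ≠ 0)
    (hxy : y - x ≠ 0) (b : ℕ) :
    x⁻¹ ^ 2 * y⁻¹ ^ b = (y - x)⁻¹ ^ b * x⁻¹ ^ 2 - b * ((y - x)⁻¹ ^ (b + 1) * x⁻¹)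
      + ∑ k ∈ Finset.range b, (k + 1 : K) * ((y - x)⁻¹ ^ (k + 2) * y⁻¹ ^ (b - k)) := by
  induction b with
  | zero => simp
  | succ b ih =>
    have h1 : x⁻¹ * y⁻¹ = (y - x)⁻¹ * x⁻¹ - (y - x)⁻¹ * y⁻¹ := by
      field_simp
    have h2 : ∑ k ∈ Finset.range b, (k + 1 : K) * ((y - x)⁻¹ ^ (k + 2) * y⁻¹ ^ (b + 1 - k)) =
        (∑ k ∈ Finset.range b, (k + 1 : K) * ((y - x)⁻¹ ^ (k + 2) * y⁻¹ ^ (b - k))) * y⁻¹ := by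
      rw [Finset.sum_mul]
      refine Finset.sum_congr rfl fun k hk => ?_
      rw [Nat.succ_sub (Finset.mem_range.1 hk).le, pow_succ y⁻¹]
      ring
    rw [Finset.sum_range_succ, h2, pow_succ y⁻¹, ← mul_assoc, ih]
    have h3 : b + 1 - b = 1 := by omega
    rw [h3]
    generalize (y - x)⁻¹ = n at *
    generalize x⁻¹ = u at *
    generalize y⁻¹ = v at *
    push_cast
    -- The term `u ^ 2 * v` needs the splitting twice (first two coefficients), the term `u * v`
    -- once (the last).
    linear_combination (n ^ b * u - n ^ (b + 1) - b * n ^ (b + 1)) * h1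

/-! ### Pairs of equal degree and power sums over units -/

section PowerSums

variable {F : Type*} [Field F] [Finite F] {K : Type*} [Field K]

/-- The polynomials that are distinct from `a`, monic, and of the same degree as `a`. -/
noncomputable def monicSiblings (a : F[X]) : Finset F[X] := by
  classical
  exact (monicLT F (a.natDegree + 1)).filter fun c => c.natDegree = a.natDegree ∧ c ≠ a

theorem mem_monicSiblings {a c : F[X]} :
    c ∈ monicSiblings a ↔ c.Monic ∧ c.natDegree = a.natDegree ∧ c ≠ a := by
  simp only [monicSiblings, Finset.mem_filter, mem_monicLT]
  constructor
  · tauto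
  · rintro ⟨h1, h2, h3⟩
    exact ⟨⟨h1, by omega⟩, h2, h3⟩

/-- Leading terms cancel in `c - a`; factoring out its leading coefficient `θ` leaves a monic `m` of
smaller degree, and `c = a + θ m` inverts this. -/
theorem sum_monicSiblings {M : Type*} [AddCommMonoid M] [Fintype Fˣ] {a : F[X]} (ha : a.Monic)
    (f : F[X] → M) :
    ∑ c ∈ monicSiblings a, f (c - a) =
      ∑ θ : Fˣ, ∑ m ∈ monicLT F a.natDegree, f (Polynomial.C (θ : F) * m) := by
  rw [← Finset.sum_product']
  have hlt {c : F[X]} (hc : c ∈ monicSiblings a) : (c - a).natDegree < a.natDegree := by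
    obtain ⟨h1, h2, h3⟩ := mem_monicSiblings.1 hc
    have h0 : a.natDegree ≠ 0 := fun h => h3 <| by
      rw [Polynomial.eq_one_of_monic_natDegree_zero ha h,
        Polynomial.eq_one_of_monic_natDegree_zero h1 (h2.trans h)]
    have hd : (c - a).degree < c.degree := by
      refine Polynomial.degree_sub_lt_left ?_ h1.ne_zero (h1.trans ha.symm)
      rw [Polynomial.degree_eq_natDegree h1.ne_zero, Polynomial.degree_eq_natDegree ha.ne_zero, h2]
    rw [← h2]
    exact Polynomial.natDegree_lt_natDegree (sub_ne_zero.2 h3) hd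
  have hlc {c : F[X]} (hc : c ∈ monicSiblings a) : (c - a).leadingCoeff ≠ 0 :=
    Polynomial.leadingCoeff_ne_zero.2 (sub_ne_zero.2 (mem_monicSiblings.1 hc).2.2)
  refine Finset.sum_bij'
    (fun c hc => (Units.mk0 _ (hlc hc), Polynomial.C (c - a).leadingCoeff⁻¹ * (c - a)))
    (fun x _ => a + Polynomial.C (x.1 : F) * x.2) ?_ ?_ ?_ ?_ ?_
  · intro c hc
    simp only [Finset.mem_product, Finset.mem_univ, true_and, mem_monicLT]
    refine ⟨?_, ?_⟩
    · rw [Polynomial.Monic, Polynomial.leadingCoeff_mul, Polynomial.leadingCoeff_C,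
        inv_mul_cancel₀ (hlc hc)]
    · rw [Polynomial.natDegree_C_mul (inv_ne_zero (hlc hc))]
      exact hlt hc
  · rintro ⟨θ, m⟩ hx
    simp only [Finset.mem_product, Finset.mem_univ, true_and, mem_monicLT] at hx
    have hdeg : (Polynomial.C (θ : F) * m).natDegree < a.natDegree := by
      rw [Polynomial.natDegree_C_mul θ.ne_zero]
      exact hx.2
    refine mem_monicSiblings.2 ⟨?_, ?_, ?_⟩
    · exact ha.add_of_left (Polynomial.degree_lt_degree hdeg)
    · exact Polynomial.natDegree_add_eq_left_of_natDegree_lt hdeg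
    · simp [hx.1.ne_zero]
  · intro c hc
    simp only [Units.val_mk0]
    rw [← mul_assoc, ← Polynomial.C_mul, mul_inv_cancel₀ (hlc hc)]
    simp
  · rintro ⟨θ, m⟩ hx
    simp only [Finset.mem_product, Finset.mem_univ, true_and, mem_monicLT] at hx
    have : (a + Polynomial.C (θ : F) * m - a).leadingCoeff = θ := by
      simp [hx.1.leadingCoeff]
    ext1
    · ext1
      exact this
    · simp only [this]
      rw [add_sub_cancel_left, ← mul_assoc, ← Polynomial.C_mul, inv_mul_cancel₀ θ.ne_zero,
        Polynomial.C_1, one_mul]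
  · intro c hc
    simp only [Units.val_mk0]
    rw [← mul_assoc, ← Polynomial.C_mul, mul_inv_cancel₀ (hlc hc)]
    simp

/-- The sum of the `j`-th powers of the elements of `Fˣ`, where `F` has `q` elements. -/
def unitPowerSum (K : Type*) [Field K] (q j : ℕ) : K :=
  if q - 1 ∣ j then -1 else 0

theorem sum_inv_pow_units [Fintype Fˣ] (φ : F →+* K) (j : ℕ) :
    ∑ θ : Fˣ, (φ (θ : F))⁻¹ ^ j = unitPowerSum K (Nat.card F) j := by
  classical
  have := Fintype.ofFinite F
  rw [← Equiv.sum_comp (Equiv.inv Fˣ)]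
  have h := congrArg φ (FiniteField.sum_pow_units F j)
  rw [map_sum] at h
  rw [unitPowerSum, Nat.card_eq_fintype_card]
  convert h using 1
  · refine Finset.sum_congr (Finset.ext fun _ => by simp) fun θ _ => ?_
    simp
  · split_ifs <;> simp

/-- The truncation at degree `D` of the double sum of `w a ^ i * w c ^ j` over
`deg a > deg c`. -/
noncomputable def truncatedDoubleSum (w : F[X] → K) (D i j : ℕ) : K :=
  ∑ a ∈ monicLT F D, ∑ c ∈ monicLT F a.natDegree, w a ^ i * w c ^ j

theorem sum_monicSiblings_inv_pow (ι : F[X] →+* K) (D i j : ℕ) :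
    ∑ a ∈ monicLT F D, ∑ c ∈ monicSiblings a, (ι a)⁻¹ ^ i * (ι (c - a))⁻¹ ^ j =
      unitPowerSum K (Nat.card F) j * truncatedDoubleSum (fun a => (ι a)⁻¹) D i j := by
  classical
  have := Fintype.ofFinite F
  rw [truncatedDoubleSum, Finset.mul_sum]
  refine Finset.sum_congr rfl fun a ha => ?_
  rw [← Finset.mul_sum, sum_monicSiblings (mem_monicLT.1 ha).1 fun n => (ι n)⁻¹ ^ j,
    ← sum_inv_pow_units (ι.comp Polynomial.C), Finset.sum_mul, Finset.mul_sum]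
  refine Finset.sum_congr rfl fun θ _ => ?_
  rw [Finset.mul_sum, Finset.mul_sum]
  refine Finset.sum_congr rfl fun m _ => ?_
  rw [map_mul, mul_inv, mul_pow, RingHom.comp_apply]
  ring

theorem sum_monicSiblings_comm {M : Type*} [AddCommMonoid M] (D : ℕ) (f : F[X] → F[X] → M) :
    ∑ a ∈ monicLT F D, ∑ c ∈ monicSiblings a, f a c =
      ∑ a ∈ monicLT F D, ∑ c ∈ monicSiblings a, f c a := by
  refine Finset.sum_comm' fun a c => ?_
  simp only [mem_monicLT, mem_monicSiblings]
  constructor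
  · rintro ⟨⟨h1, h2⟩, h3, h4, h5⟩
    exact ⟨⟨h1, h4.symm, h5.symm⟩, h3, by omega⟩
  · rintro ⟨⟨h1, h2, h3⟩, h4, h5⟩
    exact ⟨⟨h1, by omega⟩, h4, h2.symm, h3.symm⟩

theorem neg_one_pow_card_sub_one (φ : F →+* K) : (-1 : K) ^ (Nat.card F - 1) = 1 := by
  have := Fintype.ofFinite F
  have h := congrArg φ (FiniteField.pow_card_sub_one_eq_one (-1 : F) (by simp))
  simpa [Nat.card_eq_fintype_card] using h

/-- When `q - 1 ∣ j` the sign is `1`, because `-1` is a unit of `F`. This makes the roles of `a` and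
`c` interchangeable below. -/
theorem neg_one_pow_mul_unitPowerSum (φ : F →+* K) (j : ℕ) :
    (-1) ^ j * unitPowerSum K (Nat.card F) j = unitPowerSum K (Nat.card F) j := by
  unfold unitPowerSum
  split_ifs with h
  · obtain ⟨e, rfl⟩ := h
    rw [pow_mul, neg_one_pow_card_sub_one φ]
    simp
  · simp

theorem sum_monicSiblings_inv_pow_right (ι : F[X] →+* K) (D i j : ℕ) :
    ∑ a ∈ monicLT F D, ∑ c ∈ monicSiblings a, (ι c)⁻¹ ^ i * (ι (c - a))⁻¹ ^ j =
      unitPowerSum K (Nat.card F) j * truncatedDoubleSum (fun a => (ι a)⁻¹) D i j := by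
  rw [sum_monicSiblings_comm, ← neg_one_pow_mul_unitPowerSum (ι.comp Polynomial.C), mul_assoc,
    ← sum_monicSiblings_inv_pow, Finset.mul_sum]
  refine Finset.sum_congr rfl fun a _ => ?_
  rw [Finset.mul_sum]
  refine Finset.sum_congr rfl fun c _ => ?_
  rw [← neg_sub c a, map_neg, inv_neg, neg_pow]
  ring

theorem sum_mul_sum_monicLT (w : F[X] → K) (D i j : ℕ) :
    (∑ a ∈ monicLT F D, w a ^ i) * ∑ a ∈ monicLT F D, w a ^ j =
      ∑ a ∈ monicLT F D, w a ^ (i + j) + truncatedDoubleSum w D i j + truncatedDoubleSum w D j i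
        + ∑ a ∈ monicLT F D, ∑ c ∈ monicSiblings a, w a ^ i * w c ^ j := by
  classical
  have h : truncatedDoubleSum w D j i =
      ∑ a ∈ monicLT F D, ∑ c ∈ (monicLT F D).filter fun c => a.natDegree < c.natDegree,
        w a ^ i * w c ^ j := by
    unfold truncatedDoubleSum
    simp_rw [mul_comm (w _ ^ j)]
    refine Finset.sum_comm' fun a c => ?_
    simp only [mem_monicLT, Finset.mem_filter]
    constructor
    · rintro ⟨⟨h1, h2⟩, h3, h4⟩
      exact ⟨⟨⟨h1, h2⟩, h4⟩, h3, by omega⟩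
    · rintro ⟨⟨⟨h1, h2⟩, h3⟩, h4, h5⟩
      exact ⟨⟨h1, h2⟩, h4, h3⟩
  rw [h, truncatedDoubleSum, Finset.sum_mul_sum, ← Finset.sum_add_distrib,
    ← Finset.sum_add_distrib, ← Finset.sum_add_distrib]
  refine Finset.sum_congr rfl fun a ha => ?_
  obtain ⟨ham, haD⟩ := mem_monicLT.1 ha
  rw [← Finset.sum_filter_add_sum_filter_not (monicLT F D) fun c => c.natDegree < a.natDegree,
    ← Finset.sum_filter_add_sum_filter_not
      ((monicLT F D).filter fun c => ¬ c.natDegree < a.natDegree)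
      fun c => a.natDegree < c.natDegree, Finset.filter_filter, Finset.filter_filter]
  have h1 : (monicLT F D).filter (fun c => c.natDegree < a.natDegree) = monicLT F a.natDegree := by
    ext c
    simp only [mem_monicLT, Finset.mem_filter]
    exact ⟨fun h => ⟨h.1.1, h.2⟩, fun h => ⟨⟨h.1, by omega⟩, h.2⟩⟩
  have h2 : (monicLT F D).filter (fun c => ¬ c.natDegree < a.natDegree ∧
      a.natDegree < c.natDegree) = (monicLT F D).filter fun c => a.natDegree < c.natDegree :=
    Finset.filter_congr fun c _ => by omega
  have h3 : (monicLT F D).filter (fun c => ¬ c.natDegree < a.natDegree ∧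
      ¬ a.natDegree < c.natDegree) = insert a (monicSiblings a) := by
    ext c
    simp only [mem_monicLT, Finset.mem_filter, Finset.mem_insert, mem_monicSiblings]
    constructor
    · rintro ⟨⟨h1, h2⟩, h3, h4⟩
      exact (em (c = a)).imp_right fun h => ⟨h1, by omega, h⟩
    · rintro (rfl | ⟨h1, h2, h3⟩)
      · simp [ham, haD]
      · exact ⟨⟨h1, by omega⟩, by omega, by omega⟩
  rw [h1, h2, h3, Finset.sum_insert (by simp [mem_monicSiblings]), pow_add]
  ring

/-- Apply partial fractions to each pair with `x = a`, `y = c`. Index `k` of the expansion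
corresponds to `l = k + 2`. -/
theorem sum_monicSiblings_sq_mul_pow {ι : F[X] →+* K} (hι : Function.Injective ι) (D : ℕ) {b : ℕ}
    (hb : 0 < b) :
    ∑ a ∈ monicLT F D, ∑ c ∈ monicSiblings a, (ι a)⁻¹ ^ 2 * (ι c)⁻¹ ^ b =
      ∑ l ∈ Finset.Ico 1 b, ((l : K) - 1) * unitPowerSum K (Nat.card F) l *
          truncatedDoubleSum (fun a => (ι a)⁻¹) D (b + 2 - l) l
        + b * unitPowerSum K (Nat.card F) b * truncatedDoubleSum (fun a => (ι a)⁻¹) D 2 b := by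
  have hne {a : F[X]} (ha : a ≠ 0) : ι a ≠ 0 := (map_ne_zero_iff ι hι).2 ha
  set h : ℕ → K := fun l => ((l : K) - 1) * unitPowerSum K (Nat.card F) l *
    truncatedDoubleSum (fun a => (ι a)⁻¹) D (b + 2 - l) l with hh
  have key : ∑ a ∈ monicLT F D, ∑ c ∈ monicSiblings a, (ι a)⁻¹ ^ 2 * (ι c)⁻¹ ^ b =
      unitPowerSum K (Nat.card F) b * truncatedDoubleSum (fun a => (ι a)⁻¹) D 2 b
      - b * (unitPowerSum K (Nat.card F) (b + 1) *
          truncatedDoubleSum (fun a => (ι a)⁻¹) D 1 (b + 1))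
      + ∑ k ∈ Finset.range b, h (k + 2) := by
    have hk (k : ℕ) : h (k + 2) = ((k : K) + 1) * (unitPowerSum K (Nat.card F) (k + 2) *
        truncatedDoubleSum (fun a => (ι a)⁻¹) D (b - k) (k + 2)) := by
      simp only [hh, Nat.add_sub_add_right]
      push_cast
      ring
    rw [← sum_monicSiblings_inv_pow, ← sum_monicSiblings_inv_pow]
    simp_rw [hk, ← sum_monicSiblings_inv_pow_right]
    simp_rw [Finset.mul_sum]
    rw [Finset.sum_comm (s := Finset.range b)]
    simp_rw [Finset.sum_comm (s := Finset.range b)]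
    simp_rw [← Finset.sum_sub_distrib, ← Finset.sum_add_distrib]
    refine Finset.sum_congr rfl fun a ha => Finset.sum_congr rfl fun c hc => ?_
    obtain ⟨hc1, -, hc2⟩ := mem_monicSiblings.1 hc
    have hca := hne (sub_ne_zero.2 hc2)
    rw [map_sub] at hca ⊢
    rw [partial_fraction_sq (hne (mem_monicLT.1 ha).1.ne_zero) (hne hc1.ne_zero) hca]
    simp_rw [mul_comm ((ι c - ι a)⁻¹ ^ _), pow_one]
  -- The term `l = 1` vanishes and may be added. The term `l = b + 1` will cancel the `-b` term of
  -- `key`, and `l = b`, with coefficient `b - 1`, merges with its first term to give `b`.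
  have hsum : ∑ k ∈ Finset.range b, h (k + 2) = ∑ l ∈ Finset.Ico 1 b, h l + h b + h (b + 1) := by
    rw [← Finset.sum_Ico_succ_top hb, ← Finset.sum_Ico_succ_top (by omega),
      Finset.sum_eq_sum_Ico_succ_bot (by omega), show h 1 = 0 by simp [hh], zero_add,
      Finset.sum_Ico_eq_sum_range]
    exact Finset.sum_congr (by simp) fun k _ => by rw [add_comm]
  rw [key, hsum]
  have e1 : b + 2 - b = 2 := by omega
  have e2 : b + 2 - (b + 1) = 1 := by omega
  simp only [hh, e1, e2]
  push_cast
  ring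

end PowerSums

/-! ### Reindexing by multiples of `q - 1` -/

theorem two_add_shufflePhi {p : ℕ} (hp : p.Prime) (q i : ℕ) {j : ℕ} (hj : j < p) :
    2 + shufflePhi p q 2 i (p - 1 - j) = ((q : ℤ) - 1) * (j + 1 + p * i) := by
  have h2 : Nat.clog p 2 = 1 := Nat.clog_eq_one le_rfl hp.two_le
  have h3 : ((p - 1 - j : ℕ) : ℤ) = p - 1 - j := by omega
  rw [shufflePhi, recursionLength, h2, h3]
  push_cast
  ring

/-- With `l = 2 + φ(i, p - 1 - j) = (q - 1)(j + 1 + p i)`, the condition `b - φ > 2` becomes `l <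
b`. Division with remainder by `p` then matches the pairs `(j, i)` with the positive multiples of `q
- 1` below `b`. -/
theorem sum_mul_finsum_shuffle {K : Type*} [Field K] {p q : ℕ} (hp : p.Prime) (hq : 1 < q)
    (hpK : (p : K) = 0) (hqK : (q : K) = 0) (b : ℕ) (G : ℤ → ℤ → K) :
    ∑ j ∈ Finset.range p, ((j + 2 : ℕ) : K) * ∑ᶠ i ∈ shuffleIndexSet p q 2 b (p - 1 - j),
        G (b - shufflePhi p q 2 i (p - 1 - j)) (2 + shufflePhi p q 2 i (p - 1 - j)) =
      ∑ l ∈ (Finset.Ico 1 b).filter (q - 1 ∣ ·), (1 - (l : K)) * G ((b + 2 - l : ℕ) : ℤ) l := by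
  have hmem {i j : ℕ} (hj : j < p) :
      i ∈ shuffleIndexSet p q 2 b (p - 1 - j) ↔ (q - 1) * (j + 1 + p * i) < b := by
    have h := two_add_shufflePhi hp q i hj
    have hc : (((q - 1) * (j + 1 + p * i) : ℕ) : ℤ) = 2 + shufflePhi p q 2 i (p - 1 - j) := by
      rw [h]
      push_cast [hq.le]
      ring
    simp only [shuffleIndexSet, Set.mem_ofPred_eq]
    omega
  have hlhs : ∀ j ∈ Finset.range p, ((j + 2 : ℕ) : K) *
      ∑ᶠ i ∈ shuffleIndexSet p q 2 b (p - 1 - j),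
        G (b - shufflePhi p q 2 i (p - 1 - j)) (2 + shufflePhi p q 2 i (p - 1 - j)) =
      ∑ i ∈ (shuffleIndexSet_finite hp.one_lt hq 2 b (p - 1 - j)).toFinset, ((j + 2 : ℕ) : K) *
        G (b - shufflePhi p q 2 i (p - 1 - j)) (2 + shufflePhi p q 2 i (p - 1 - j)) := by
    intro j hj
    rw [finsum_mem_eq_finite_toFinset_sum _ (shuffleIndexSet_finite hp.one_lt hq 2 b (p - 1 - j)),
      Finset.mul_sum]
  rw [Finset.sum_congr rfl hlhs, Finset.sum_sigma']
  have hq0 : 0 < q - 1 := by omega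
  refine Finset.sum_bij' (fun x _ => (q - 1) * (x.1 + 1 + p * x.2))
    (fun l _ => ⟨(l / (q - 1) - 1) % p, (l / (q - 1) - 1) / p⟩) ?_ ?_ ?_ ?_ ?_
  · rintro ⟨j, i⟩ hx
    simp only [Finset.mem_sigma, Finset.mem_range, Set.Finite.mem_toFinset] at hx
    simp only [Finset.mem_filter, Finset.mem_Ico, dvd_mul_right, and_true]
    exact ⟨Nat.mul_pos hq0 (by omega), (hmem hx.1).1 hx.2⟩
  · intro l hl
    simp only [Finset.mem_filter, Finset.mem_Ico] at hl
    obtain ⟨⟨hl1, hl2⟩, e, rfl⟩ := hl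
    have he : 0 < e := Nat.pos_of_mul_pos_left hl1
    have hj := Nat.mod_lt (e - 1) hp.pos
    rw [Nat.mul_div_cancel_left _ hq0]
    simp only [Finset.mem_sigma, Finset.mem_range, Set.Finite.mem_toFinset]
    refine ⟨hj, (hmem hj).2 ?_⟩
    have := Nat.mod_add_div (e - 1) p
    rwa [show (e - 1) % p + 1 + p * ((e - 1) / p) = e by omega]
  · rintro ⟨j, i⟩ hx
    simp only [Finset.mem_sigma, Finset.mem_range, Set.Finite.mem_toFinset] at hx
    simp only [Nat.mul_div_cancel_left _ hq0]
    rw [show j + 1 + p * i - 1 = j + p * i by omega, Nat.add_mul_mod_self_left,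
      Nat.mod_eq_of_lt hx.1, Nat.add_mul_div_left _ _ hp.pos, Nat.div_eq_of_lt hx.1, zero_add]
  · intro l hl
    simp only [Finset.mem_filter, Finset.mem_Ico] at hl
    obtain ⟨⟨hl1, hl2⟩, e, rfl⟩ := hl
    have he : 0 < e := Nat.pos_of_mul_pos_left hl1
    simp only [Nat.mul_div_cancel_left _ hq0]
    have := Nat.mod_add_div (e - 1) p
    rw [show (e - 1) % p + 1 + p * ((e - 1) / p) = e by omega]
  · rintro ⟨j, i⟩ hx
    simp only [Finset.mem_sigma, Finset.mem_range, Set.Finite.mem_toFinset] at hx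
    have h := two_add_shufflePhi hp q i hx.1
    have hlt := (hmem hx.1).1 hx.2
    have hc : (((q - 1) * (j + 1 + p * i) : ℕ) : ℤ) = 2 + shufflePhi p q 2 i (p - 1 - j) := by
      rw [h]
      push_cast [hq.le]
      ring
    have hb : ((b + 2 - (q - 1) * (j + 1 + p * i) : ℕ) : ℤ) =
        b - shufflePhi p q 2 i (p - 1 - j) := by
      omega
    simp only [hb, hc]
    -- Since `q = p = 0` in `K`, `l = -(j + 1)`, so `1 - l = j + 2`.
    congr 1
    push_cast [hq.le, hpK, hqK]
    ring

/-! ### Passage to the limit -/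

theorem tendsto_truncatedDoubleSum {F : Type*} [Field F] [Finite F] {s t : ℕ} (hs : 0 < s)
    (ht : 0 < t) :
    Tendsto (fun D => truncatedDoubleSum (fun a => (polyToKInfty F a)⁻¹) D s t) atTop
      (𝓝 (multizeta F ![(s : ℤ), (t : ℤ)])) :=
  tendsto_sum_multizeta_two hs ht

theorem multizeta_two_mul (F : Type*) [Field F] [Finite F] {b : ℕ} (hb : 0 < b) :
    multizeta F ![2] * multizeta F ![(b : ℤ)] =
      multizeta F ![2 + (b : ℤ)] + multizeta F ![2, (b : ℤ)] + multizeta F ![(b : ℤ), 2]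
      + (∑ l ∈ Finset.Ico 1 b, ((l : KInfty F) - 1) * unitPowerSum (KInfty F) (Nat.card F) l *
          multizeta F ![((b + 2 - l : ℕ) : ℤ), (l : ℤ)]
        + b * unitPowerSum (KInfty F) (Nat.card F) b * multizeta F ![2, (b : ℤ)]) := by
  have hprod := (tendsto_sum_multizeta_one (F := F) two_pos).mul (tendsto_sum_multizeta_one hb)
  have hsum := (((tendsto_sum_multizeta_one (F := F) (s := 2 + b) (by omega)).add
    (tendsto_truncatedDoubleSum two_pos hb)).add (tendsto_truncatedDoubleSum hb two_pos)).add
    ((tendsto_finsetSum (Finset.Ico 1 b) fun l hl =>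
      (tendsto_truncatedDoubleSum (F := F) (s := b + 2 - l) (t := l)
        (by have := Finset.mem_Ico.1 hl; omega) (by have := Finset.mem_Ico.1 hl; omega)).const_mul
      (((l : KInfty F) - 1) * unitPowerSum (KInfty F) (Nat.card F) l)).add
    ((tendsto_truncatedDoubleSum two_pos hb).const_mul
      ((b : KInfty F) * unitPowerSum (KInfty F) (Nat.card F) b)))
  push_cast at hprod hsum
  refine tendsto_nhds_unique hprod (hsum.congr fun D => ?_)
  rw [sum_mul_sum_monicLT, sum_monicSiblings_sq_mul_pow (polyToKInfty_injective F) D hb]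

theorem theorem7p7 (p q : ℕ) (hp : p.Prime) (hq : ∃ s : ℕ, 0 < s ∧ q = p ^ s)
    (F : Type*) [Field F] [Finite F] (hF : Nat.card F = q) (b : ℕ) (hb : 0 < b) :
    (∀ (r : ℕ) (s : Fin r → ℤ), (∀ i, 0 < s i) → Summable (multizetaTerm F s)) ∧
    multizeta F ![2] * multizeta F ![(b : ℤ)] =
      multizeta F ![2 + (b : ℤ)] + multizeta F ![2, (b : ℤ)] + multizeta F ![(b : ℤ), 2]
      + ∑ j ∈ Finset.range p, ((j + 2 : ℕ) : KInfty F) *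
          ∑ᶠ i ∈ shuffleIndexSet p q 2 b (p - 1 - j),
            multizeta F ![(b : ℤ) - shufflePhi p q 2 i (p - 1 - j),
              2 + shufflePhi p q 2 i (p - 1 - j)]
      + (if (q - 1) ∣ b then ((b / (q - 1) : ℕ) : KInfty F) else 0)
          * multizeta F ![2, (b : ℤ)] := by
  refine ⟨fun r s hs => summable_multizetaTerm hs, ?_⟩
  obtain ⟨s, hs, hqs⟩ := hq
  have hq1 : 1 < q := hqs ▸ Nat.one_lt_pow hs.ne' hp.one_lt
  have hqF : (q : F) = 0 := by
    have := Fintype.ofFinite F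
    rw [← hF, Nat.card_eq_fintype_card]
    exact FiniteField.cast_card_eq_zero F
  have hpF : (p : F) = 0 := by
    rw [hqs, Nat.cast_pow] at hqF
    exact eq_zero_of_pow_eq_zero hqF
  have hqK : (q : KInfty F) = 0 := by
    simpa using congrArg ((polyToKInfty F).comp Polynomial.C) hqF
  have hpK : (p : KInfty F) = 0 := by
    simpa using congrArg ((polyToKInfty F).comp Polynomial.C) hpF
  rw [multizeta_two_mul F hb, sum_mul_finsum_shuffle hp hq1 hpK hqK b
    fun x y => multizeta F ![x, y], hF, add_assoc (_ + _ + _)]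
  congr 2
  · rw [Finset.sum_filter]
    refine Finset.sum_congr rfl fun l _ => ?_
    unfold unitPowerSum
    split_ifs <;> ring
  · congr 1
    unfold unitPowerSum
    split_ifs with h
    -- For `b = (q - 1) e` the coefficient `-b` equals `e`, as `q = 0` in `K_∞`.
    · obtain ⟨e, rfl⟩ := h
      rw [Nat.mul_div_cancel_left _ (by omega)]
      push_cast [hq1.le, hqK]
      ring
    · simp
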